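/- Let $w(x)=(1-x^2)^{-1/2}$ on $\Omega=[-1,1]$, let $T_n$ be the Chebyshev polynomials of the first kind, and let $(\cdot,\cdot)_w$, $\|\cdot\|_w$ be the inner product and norm of $L^2_w(\Omega)$. For $s\ge 0$ let $H^s_w(\Omega)$ be the Chebyshev-weighted Sobolev space of all $f\in L^2_w(\Omega)$ with $$\|f\|_{H^s_w}^2=\sum_{n\ge 0}(1+n^2)^s\,\frac{(f,T_n)_w^2}{\|T_n\|_w^2}<\infty$$ (equivalently, $\theta\mapsto f(\cos\theta)$ lies in the periodic Sobolev space of order $s$). Let $X_s=C^1([0,T];H^s_w(\Omega))$ with norm $$\|u\|_{X_s}^2=\max_{t\in[0,T]}\bigl(\|u(\cdot,t)\|_{H^s_w}^2+\|\partial_t u(\cdot,t)\|_{H^s_w}^2\bigr).$$ Let $\delta,T>0$, let $k:\mathbb R\to\mathbb R$ be a bounded measurable kernel (for instance $|z|^{-1-2\alpha}$, $\alpha\in(0,1)$, with the self-interaction of points closer than some $\varepsilon>0$ removed), and let $$\mathcal L u(x)=\int_{(x-\delta,x+\delta)\cap[-1,1]}k(x-x')\,\bigl(u(x)-u(x')\bigr)\,dx'.$$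 Let $P_N$ be the $(\cdot,\cdot)_w$-orthogonal projection of $L^2_w(\Omega)$ onto $S_N=\mathrm{span}\{T_k:|k|\le N\}$. Then there is a constant $C>0$, depending only on $k,\delta,T$ (so not on $N$, $s$ or $u$), such that the following holds. Let $s\ge 1$, let $u_0,v\in H^s_w(\Omega)$, and let $u\in X_s$ solve the nonlocal Sine-Gordon problem $$\partial_{tt}^2u=\mathcal L u-\sin u\ \text{ on }[0,T],\qquad u(\cdot,0)=u_0,\quad \partial_tu(\cdot,0)=v .$$ Let $N\ge 1$ and let $u^N$, with $u^N(\cdot,t)\in S_N$ for $0\le t\le T$, solve the Chebyshev--Galerkin semi-discrete scheme $$\partial_{tt}^2u^N=P_N\mathcal L(u^N)-P_N\sin(u^N)\ \text{ on }[0,T],\qquad u^N(\cdot,0)=P_Nu_0,\quad \partial_tu^N(\cdot,0)=P_Nv .$$ Then $u-u^N\in X_1$ and $$\|u-u^N\|_{X_1}\le C\,N^{1-s}\,\|u\|_{X_s}.$$ No boundary condition on $u$ or $u^N$ is needed; in particular the estimate holds whenever $u^N$ satisfies in addition the Neumann conditions $\partial_xu^N(\pm1,t)=0$. -/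

import Mathlib

open MeasureTheory Filter Topology Set

noncomputable section

namespace NonlocalSineGordon

/-- The Chebyshev measure `w(x) dx` on `[-1, 1]`, with `w(x) = (1 - x^2)^(-1/2)`. -/
abbrev chebMeasure : Measure ℝ := Polynomial.Chebyshev.measureT

/-- The weighted space `L²_w(-1, 1)`, a real Hilbert space with inner product
`(u, v)_w = ∫ u v w dx`. -/
abbrev L2w : Type := Lp ℝ 2 chebMeasure

instance instIsFiniteMeasureCheb : IsFiniteMeasure chebMeasure := by
  have h : Integrable (fun _ : ℝ => (1 : ℝ)) chebMeasure :=
    Polynomial.Chebyshev.integrable_measureT continuousOn_const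
  exact (integrable_const_iff_isFiniteMeasure one_ne_zero).1 h

theorem memLp_polynomial (p : Polynomial ℝ) :
    MemLp (fun x => p.eval x) 2 chebMeasure := by
  have hc : Continuous fun x => p.eval x := p.continuous
  rw [memLp_two_iff_integrable_sq hc.aestronglyMeasurable]
  exact Polynomial.Chebyshev.integrable_measureT (hc.pow 2).continuousOn

/-- The Chebyshev polynomial of the first kind `T_n` as an element of `L²_w`. For a negative index
`T_{-n} = T_n`. -/
def chebT (n : ℤ) : L2w := (memLp_polynomial (Polynomial.Chebyshev.T ℝ n)).toLp _

/-- The space `S_N`, spanned by the `T_k` with `|k| ≤ N`. -/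
def polySpace (N : ℕ) : Submodule ℝ L2w :=
  Submodule.span ℝ (chebT '' {k : ℤ | |k| ≤ (N : ℤ)})

instance instFiniteDimensionalPolySpace (N : ℕ) : FiniteDimensional ℝ (polySpace N) := by
  have hfin : {k : ℤ | |k| ≤ (N : ℤ)}.Finite :=
    (finite_Icc (-(N : ℤ)) N).subset fun k hk => abs_le.1 hk
  exact FiniteDimensional.span_of_finite ℝ (hfin.image _)

/-- The orthogonal projection `P_N : L²_w → S_N`, characterised by `(u - P_N u, φ)_w = 0` for all
`φ ∈ S_N`. -/
def proj (N : ℕ) : L2w →L[ℝ] L2w := (polySpace N).starProjection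

/-- The coefficient of `u` on the normalised Chebyshev polynomial `T_n / ‖T_n‖_w`. -/
def coeff (n : ℕ) (u : L2w) : ℝ := inner ℝ (chebT n) u / ‖chebT n‖

/-- `u ∈ H^s_w`: the Chebyshev coefficients of `u` are square summable with weight
`(1 + n^2)^s`; equivalently `θ ↦ u (cos θ)` is in the periodic Sobolev space of order `s`. -/
def MemHs (s : ℝ) (u : L2w) : Prop :=
  Summable fun n : ℕ => (1 + (n : ℝ) ^ 2) ^ s * coeff n u ^ 2

/-- The norm of `H^s_w`. For `s = 0` it is the norm of `L²_w`. -/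
def hsNorm (s : ℝ) (u : L2w) : ℝ :=
  √(∑' n : ℕ, (1 + (n : ℝ) ^ 2) ^ s * coeff n u ^ 2)

/-- The time derivative on `[0, T]` (one-sided at the end points), taken in `L²_w`. -/
def timeDeriv (T : ℝ) (u : ℝ → L2w) (t : ℝ) : L2w := derivWithin u (Icc 0 T) t

/-- `u ∈ X_s = C¹([0, T]; H^s_w)`: on `[0, T]`, `u` and `∂ₜu` take values in `H^s_w`, the difference
quotients of `u` converge to `∂ₜu` in the norm of `H^s_w`, and `∂ₜu` is continuous in that norm. -/
structure MemX (s T : ℝ) (u : ℝ → L2w) : Prop where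
  memHs : ∀ t ∈ Icc 0 T, MemHs s (u t)
  memHs_timeDeriv : ∀ t ∈ Icc 0 T, MemHs s (timeDeriv T u t)
  differentiable : ∀ t ∈ Icc 0 T, DifferentiableWithinAt ℝ u (Icc 0 T) t
  tendsto_quotient : ∀ t ∈ Icc 0 T,
    Tendsto (fun r => hsNorm s ((r - t)⁻¹ • (u r - u t) - timeDeriv T u t))
      (𝓝[Icc 0 T \ {t}] t) (𝓝 0)
  continuous_timeDeriv : ∀ t ∈ Icc 0 T,
    Tendsto (fun r => hsNorm s (timeDeriv T u r - timeDeriv T u t)) (𝓝[Icc 0 T] t) (𝓝 0)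

/-- The norm of `X_s`: the square root of the maximum over `t ∈ [0, T]` of
`‖u(t)‖² + ‖∂ₜu(t)‖²`, with norms in `H^s_w`. -/
def xNorm (s T : ℝ) (u : ℝ → L2w) : ℝ :=
  √(⨆ t : Icc (0 : ℝ) T, (hsNorm s (u t) ^ 2 + hsNorm s (timeDeriv T u t) ^ 2))

/-- A bounded measurable interaction kernel. -/
structure Kernel where
  toFun : ℝ → ℝ
  measurable : Measurable toFun
  bound : ℝ
  abs_le : ∀ z, |toFun z| ≤ bound

/-- The kernel `|z|^(-(1 + 2α))` without self-interaction: points at distance less than `ε` do not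
interact. -/
def powerKernel (α ε : ℝ) (hα : 0 < α) (hε : 0 < ε) : Kernel where
  toFun z := if ε ≤ |z| then |z| ^ (-(1 + 2 * α)) else 0
  measurable := by
    refine Measurable.ite (measurableSet_le measurable_const measurable_id.abs) ?_ measurable_const
    exact measurable_id.abs.pow_const _
  bound := ε ^ (-(1 + 2 * α))
  abs_le z := by
    split_ifs with h
    · rw [abs_of_nonneg (Real.rpow_nonneg (abs_nonneg z) _)]
      exact Real.rpow_le_rpow_of_nonpos hε h (by linarith)
    · simpa using Real.rpow_nonneg hε.le _

/-- `∫_{Ω_x} k(x - x') (u(x) - u(x')) dx'` with `Ω_x = (x - δ, x + δ) ∩ [-1, 1]`. -/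
def nonlocalFun (k : Kernel) (δ : ℝ) (u : ℝ → ℝ) (x : ℝ) : ℝ :=
  ∫ y in Metric.ball x δ ∩ Icc (-1) 1, k.toFun (x - y) * (u x - u y)

theorem restrict_le_chebMeasure : volume.restrict (Icc (-1 : ℝ) 1) ≤ chebMeasure := by
  have hw : Measurable fun x : ℝ => ENNReal.ofNNReal (NNReal.mk (√(1 - x ^ 2)⁻¹) (by positivity)) := by
    fun_prop
  rw [← restrict_Ioo_eq_restrict_Icc, chebMeasure, Polynomial.Chebyshev.measureT,
    ← restrict_Ioo_eq_restrict_Ioc, restrict_withDensity measurableSet_Ioo]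
  calc volume.restrict (Ioo (-1 : ℝ) 1)
      = (volume.restrict (Ioo (-1 : ℝ) 1)).withDensity 1 := withDensity_one.symm
    _ ≤ _ := by
      refine withDensity_mono ?_
      filter_upwards [ae_restrict_mem measurableSet_Ioo] with x hx
      have h1 : 0 < 1 - x ^ 2 := by nlinarith [hx.1, hx.2]
      have h2 : (1 : ℝ) ≤ √(1 - x ^ 2)⁻¹ := by
        rw [Real.one_le_sqrt]
        exact (one_le_inv₀ h1).2 (by nlinarith [sq_nonneg x])
      simp only [Pi.one_apply]
      exact_mod_cast (show (1 : NNReal) ≤ NNReal.mk (√(1 - x ^ 2)⁻¹) (by positivity) from h2)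

theorem memLp_nonlocalFun (k : Kernel) (δ : ℝ) (u : L2w) :
    MemLp (nonlocalFun k δ u) 2 chebMeasure := by
  have hu : MemLp u 2 chebMeasure := Lp.memLp u
  have hsm : StronglyMeasurable u := Lp.stronglyMeasurable u
  have hint : Integrable u (volume.restrict (Icc (-1 : ℝ) 1)) :=
    (hu.integrable (by norm_num)).mono_measure restrict_le_chebMeasure
  have hM : 0 ≤ k.bound := (abs_nonneg _).trans (k.abs_le 0)
  set I : ℝ := ∫ y in Icc (-1 : ℝ) 1, ‖u y‖ with hI
  have hmeas : AEStronglyMeasurable (nonlocalFun k δ u) chebMeasure := by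
    have hset : MeasurableSet {p : ℝ × ℝ | p.2 ∈ Metric.ball p.1 δ} := by
      simp only [Metric.mem_ball]
      exact measurableSet_lt (measurable_snd.dist measurable_fst) measurable_const
    have hf : StronglyMeasurable fun p : ℝ × ℝ =>
        {p : ℝ × ℝ | p.2 ∈ Metric.ball p.1 δ}.indicator
          (fun p => k.toFun (p.1 - p.2) * (u p.1 - u p.2)) p := by
      refine StronglyMeasurable.indicator ?_ hset
      refine Measurable.stronglyMeasurable ?_
      exact (k.measurable.comp (measurable_fst.sub measurable_snd)).mul
        ((hsm.measurable.comp measurable_fst).sub (hsm.measurable.comp measurable_snd))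
    have h2 := hf.integral_prod_right' (ν := volume.restrict (Icc (-1 : ℝ) 1))
    convert h2.aestronglyMeasurable using 1
    funext x
    rw [nonlocalFun, ← Measure.restrict_restrict Metric.isOpen_ball.measurableSet,
      ← integral_indicator Metric.isOpen_ball.measurableSet]
    rfl
  have hg : MemLp (fun x => k.bound * (2 * ‖u x‖ + I)) 2 chebMeasure :=
    ((hu.norm.const_mul 2).add (memLp_const I)).const_mul k.bound
  refine hg.mono' hmeas (Eventually.of_forall fun x => ?_)
  have hdom : Integrable (fun y => k.bound * (‖u x‖ + ‖u y‖)) (volume.restrict (Icc (-1 : ℝ) 1)) :=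
    ((integrable_const _).add hint.norm).const_mul _
  calc ‖nonlocalFun k δ u x‖
      ≤ ∫ y in Metric.ball x δ ∩ Icc (-1) 1, k.bound * (‖u x‖ + ‖u y‖) := by
        refine norm_integral_le_of_norm_le
          (hdom.mono_measure (Measure.restrict_mono inter_subset_right le_rfl))
          (Eventually.of_forall fun y => ?_)
        rw [norm_mul]
        exact mul_le_mul (k.abs_le _) (norm_sub_le _ _) (norm_nonneg _) hM
    _ ≤ ∫ y in Icc (-1 : ℝ) 1, k.bound * (‖u x‖ + ‖u y‖) :=
        setIntegral_mono_set hdom (Eventually.of_forall fun y => by positivity)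
          (Eventually.of_forall inter_subset_right)
    _ = k.bound * (2 * ‖u x‖ + I) := by
        rw [integral_const_mul, integral_add (integrable_const _) hint.norm]
        have h2 : ∫ _ in Icc (-1 : ℝ) 1, ‖u x‖ = 2 * ‖u x‖ := by
          rw [setIntegral_const, Measure.real, Real.volume_Icc]
          norm_num
        rw [h2]

/-- The peridynamic operator `ℒ` on `L²_w`. -/
def peridynamicOp (k : Kernel) (δ : ℝ) (u : L2w) : L2w :=
  (memLp_nonlocalFun k δ u).toLp _

theorem lipschitzWith_sin : LipschitzWith 1 Real.sin :=
  LipschitzWith.of_dist_le_mul fun x y => by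
    simpa [Real.dist_eq] using Real.abs_sin_sub_sin_le x y

/-- The superposition operator `u ↦ sin u` on `L²_w`. -/
def sinOp (u : L2w) : L2w := lipschitzWith_sin.compLp Real.sin_zero u

/-- `u` solves `∂ₜₜu = ℒ u - sin u` on `[0, T]` with `u(0) = u₀`, `∂ₜu(0) = v`, the second time
derivative being taken in `L²_w`. -/
structure IsSolution (k : Kernel) (δ T : ℝ) (u₀ v : L2w) (u : ℝ → L2w) : Prop where
  differentiable : ∀ t ∈ Icc 0 T, DifferentiableWithinAt ℝ u (Icc 0 T) t
  equation : ∀ t ∈ Icc 0 T, HasDerivWithinAt (timeDeriv T u)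
    (peridynamicOp k δ (u t) - sinOp (u t)) (Icc 0 T) t
  initial : u 0 = u₀
  initial_timeDeriv : timeDeriv T u 0 = v

/-- `uN` solves the Chebyshev-Galerkin scheme of order `N` on `[0, T]`: it takes values in `S_N`,
`∂ₜₜuN = P_N ℒ uN - P_N sin uN`, `uN(0) = P_N u₀` and `∂ₜuN(0) = P_N v`. -/
structure IsGalerkinSolution (k : Kernel) (δ T : ℝ) (N : ℕ) (u₀ v : L2w) (uN : ℝ → L2w) :
    Prop where
  mem_polySpace : ∀ t ∈ Icc 0 T, uN t ∈ polySpace N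
  differentiable : ∀ t ∈ Icc 0 T, DifferentiableWithinAt ℝ uN (Icc 0 T) t
  equation : ∀ t ∈ Icc 0 T, HasDerivWithinAt (timeDeriv T uN)
    (proj N (peridynamicOp k δ (uN t)) - proj N (sinOp (uN t))) (Icc 0 T) t
  initial : uN 0 = proj N u₀
  initial_timeDeriv : timeDeriv T uN 0 = proj N v

end NonlocalSineGordon

end

noncomputable section

namespace NonlocalSineGordon

/-- A polynomial as an element of `L²_w`. -/
def polyLp : Polynomial ℝ →ₗ[ℝ] L2w where
  toFun p := (memLp_polynomial p).toLp _
  map_add' p q := by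
    rw [← MemLp.toLp_add]
    congr 1
    funext x
    simp
  map_smul' c p := by
    rw [RingHom.id_apply, ← MemLp.toLp_const_smul]
    congr 1
    funext x
    simp

theorem ae_mem_Icc_chebMeasure : ∀ᵐ x ∂chebMeasure, x ∈ Icc (-1 : ℝ) 1 := by
  unfold chebMeasure Polynomial.Chebyshev.measureT
  filter_upwards [ae_restrict_mem measurableSet_Ioc] with x hx using Ioc_subset_Icc_self hx

theorem chebT_eq_polyLp (n : ℤ) : chebT n = polyLp (Polynomial.Chebyshev.T ℝ n) := rfl

theorem inner_chebT (m n : ℤ) : inner ℝ (chebT m) (chebT n) =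
    ∫ x, (Polynomial.Chebyshev.T ℝ m).eval x * (Polynomial.Chebyshev.T ℝ n).eval x
      ∂chebMeasure := by
  rw [L2.inner_def]
  refine integral_congr_ae ?_
  filter_upwards [(memLp_polynomial (Polynomial.Chebyshev.T ℝ m)).coeFn_toLp,
    (memLp_polynomial (Polynomial.Chebyshev.T ℝ n)).coeFn_toLp] with x h1 h2
  simp only [chebT, h1, h2]
  simp [mul_comm]

theorem chebT_ne_zero (n : ℕ) : chebT n ≠ 0 := by
  intro h
  have h1 := inner_chebT n n
  rw [h, inner_zero_left] at h1
  rcases eq_or_ne n 0 with rfl | hn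
  · have := Polynomial.Chebyshev.integral_eval_T_real_mul_self_measureT_zero
    simp only [Nat.cast_zero] at h1
    rw [← h1] at this
    exact Real.pi_pos.ne this
  · rw [Polynomial.Chebyshev.integral_T_real_mul_self_measureT_of_ne_zero hn] at h1
    linarith [Real.pi_pos]

/-- The normalised Chebyshev polynomial `T_n / ‖T_n‖_w`. -/
def chebUnit (n : ℕ) : L2w := ‖chebT n‖⁻¹ • chebT n

theorem coeff_eq_inner (n : ℕ) (u : L2w) : coeff n u = inner ℝ (chebUnit n) u := by
  rw [coeff, chebUnit, real_inner_smul_left, div_eq_inv_mul]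

theorem orthonormal_chebUnit : Orthonormal ℝ chebUnit := by
  refine ⟨fun n => ?_, fun m n hmn => ?_⟩
  · rw [chebUnit, norm_smul, norm_inv, norm_norm,
      inv_mul_cancel₀ (norm_ne_zero_iff.2 (chebT_ne_zero n))]
  · simp only [chebUnit]
    rw [real_inner_smul_left, real_inner_smul_right, inner_chebT,
      Polynomial.Chebyshev.integral_eval_T_real_mul_eval_T_real_measureT_of_ne hmn]
    simp

theorem polyLp_mem_span (p : Polynomial ℝ) :
    polyLp p ∈ Submodule.span ℝ (range chebUnit) := by
  have hp : p ∈ Submodule.span ℝ (range (Polynomial.Chebyshev.chebyshevTsequence ℝ)) := by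
    rw [Polynomial.Sequence.span _ (by simp)]
    trivial
  have h2 := Submodule.mem_map_of_mem (f := polyLp) hp
  rw [Submodule.map_span] at h2
  refine Submodule.span_le.2 ?_ h2
  rintro _ ⟨_, ⟨n, rfl⟩, rfl⟩
  have : polyLp (Polynomial.Chebyshev.chebyshevTsequence ℝ n) = ‖chebT n‖ • chebUnit n := by
    rw [chebUnit, smul_inv_smul₀ (norm_ne_zero_iff.2 (chebT_ne_zero n))]
    rfl
  rw [this]
  exact Submodule.smul_mem _ _ (Submodule.subset_span ⟨n, rfl⟩)

theorem denseRange_polyLp : DenseRange polyLp := by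
  intro f
  rw [Metric.mem_closure_iff]
  intro ε hε
  obtain ⟨g, hg, hgm⟩ := (Lp.memLp f).exists_boundedContinuous_eLpNorm_sub_le (by norm_num)
    (ε := ENNReal.ofReal (ε / 3)) (by simpa using hε)
  set A : ℝ := measureUnivNNReal chebMeasure ^ (2 : ENNReal).toReal⁻¹ with hA
  have hA0 : 0 ≤ A := by positivity
  obtain ⟨p, hp⟩ := exists_polynomial_near_of_continuousOn (-1) 1 g g.continuous.continuousOn
    (ε / (3 * (A + 1))) (by positivity)
  refine ⟨polyLp p, ⟨p, rfl⟩, ?_⟩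
  have h1 : dist f (hgm.toLp g) ≤ ε / 3 := by
    rw [dist_eq_norm]
    have : f - hgm.toLp g = ((Lp.memLp f).sub hgm).toLp _ := by
      rw [MemLp.toLp_sub (Lp.memLp f) hgm, Lp.toLp_coeFn f (Lp.memLp f)]
    rw [this, Lp.norm_toLp]
    exact ENNReal.toReal_le_of_le_ofReal (by positivity) hg
  have h2 : dist (hgm.toLp g) (polyLp p) ≤ A * (ε / (3 * (A + 1))) := by
    rw [dist_comm, dist_eq_norm]
    refine (Lp.norm_le_of_ae_bound (C := ε / (3 * (A + 1))) (by positivity) ?_).trans_eq ?_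
    · filter_upwards [ae_mem_Icc_chebMeasure, Lp.coeFn_sub (polyLp p) (hgm.toLp g),
        hgm.coeFn_toLp, (memLp_polynomial p).coeFn_toLp] with x hx h3 h4 h5
      have h6 : (polyLp p : ℝ → ℝ) x = p.eval x := h5
      rw [h3, Pi.sub_apply, h4, h6]
      exact (hp x hx).le
    · simp [hA]
  have h3 : A * (ε / (3 * (A + 1))) ≤ ε / 3 := by
    rw [mul_div_assoc', div_le_div_iff₀ (by positivity) (by positivity)]
    nlinarith
  linarith [dist_triangle f (hgm.toLp g) (polyLp p)]

/-- The normalised Chebyshev polynomials form a Hilbert basis of `L²_w`. -/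
def chebBasis : HilbertBasis ℕ ℝ L2w :=
  HilbertBasis.mk orthonormal_chebUnit fun f _ =>
    closure_mono (by rintro _ ⟨p, rfl⟩; exact polyLp_mem_span p) (denseRange_polyLp f)

theorem hasSum_coeff_sq (u : L2w) : HasSum (fun n => coeff n u ^ 2) (‖u‖ ^ 2) := by
  rw [← real_inner_self_eq_norm_sq]
  have h : (fun n => coeff n u ^ 2) =
      fun n => inner ℝ u (chebBasis n) * inner ℝ (chebBasis n) u := by
    funext n
    have hb : chebBasis n = chebUnit n := congrFun (HilbertBasis.coe_mk _ _) n
    rw [hb, coeff_eq_inner, sq, real_inner_comm]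
  rw [h]
  exact chebBasis.hasSum_inner_mul_inner u u

theorem coeff_add (n : ℕ) (u v : L2w) : coeff n (u + v) = coeff n u + coeff n v := by
  simp [coeff_eq_inner, inner_add_right]

theorem coeff_sub (n : ℕ) (u v : L2w) : coeff n (u - v) = coeff n u - coeff n v := by
  simp [coeff_eq_inner, inner_sub_right]

theorem coeff_smul (n : ℕ) (c : ℝ) (u : L2w) : coeff n (c • u) = c * coeff n u := by
  simp [coeff_eq_inner, inner_smul_right]

theorem chebT_neg (n : ℤ) : chebT (-n) = chebT n := by
  simp [chebT_eq_polyLp]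

theorem chebT_mem_polySpace {n N : ℕ} (h : n ≤ N) : chebT n ∈ polySpace N :=
  Submodule.subset_span ⟨n, by simpa using h, rfl⟩

theorem coeff_eq_zero_of_mem_polySpace {n N : ℕ} (h : N < n) {u : L2w} (hu : u ∈ polySpace N) :
    coeff n u = 0 := by
  have : polySpace N ≤ LinearMap.ker (innerₛₗ ℝ (chebT n)) := by
    refine Submodule.span_le.2 ?_
    rintro _ ⟨k, hk, rfl⟩
    have hk' : k.natAbs ≤ N := by
      have : |k| ≤ N := hk
      rw [Int.abs_eq_natAbs] at this
      omega
    have hT : chebT k = chebT k.natAbs := by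
      rcases Int.natAbs_eq k with h | h
      · rw [← h]
      · conv_lhs => rw [h]
        rw [chebT_neg]
    rw [SetLike.mem_coe, LinearMap.mem_ker, innerₛₗ_apply_apply, hT, inner_chebT]
    exact Polynomial.Chebyshev.integral_eval_T_real_mul_eval_T_real_measureT_of_ne (by omega)
  have h2 := this hu
  rw [LinearMap.mem_ker, innerₛₗ_apply_apply] at h2
  rw [coeff, h2, zero_div]

theorem proj_mem_polySpace (N : ℕ) (u : L2w) : proj N u ∈ polySpace N :=
  Submodule.starProjection_apply_mem _ _

theorem coeff_sub_proj_of_le {n N : ℕ} (h : n ≤ N) (u : L2w) : coeff n (u - proj N u) = 0 := by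
  rw [coeff, real_inner_comm, proj,
    Submodule.starProjection_inner_eq_zero _ _ (chebT_mem_polySpace h), zero_div]

theorem coeff_sub_proj_of_lt {n N : ℕ} (h : N < n) (u : L2w) :
    coeff n (u - proj N u) = coeff n u := by
  rw [coeff_sub, coeff_eq_zero_of_mem_polySpace h (proj_mem_polySpace N u), sub_zero]

theorem hsNorm_nonneg (s : ℝ) (u : L2w) : 0 ≤ hsNorm s u := Real.sqrt_nonneg _

theorem hs_term_nonneg (s : ℝ) (u : L2w) (n : ℕ) :
    0 ≤ (1 + (n : ℝ) ^ 2) ^ s * coeff n u ^ 2 := by positivity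

theorem hsNorm_sq (s : ℝ) (u : L2w) :
    hsNorm s u ^ 2 = ∑' n : ℕ, (1 + (n : ℝ) ^ 2) ^ s * coeff n u ^ 2 :=
  Real.sq_sqrt (tsum_nonneg (hs_term_nonneg s u))

theorem hsNorm_zero (u : L2w) : hsNorm 0 u = ‖u‖ := by
  rw [hsNorm]
  simp only [Real.rpow_zero, one_mul]
  rw [(hasSum_coeff_sq u).tsum_eq, Real.sqrt_sq (norm_nonneg u)]

theorem MemHs.add {s : ℝ} {u v : L2w} (hu : MemHs s u) (hv : MemHs s v) : MemHs s (u + v) := by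
  refine Summable.of_nonneg_of_le (hs_term_nonneg s _) (fun n => ?_)
    ((Summable.mul_left 2 hu).add (Summable.mul_left 2 hv))
  have : 0 ≤ (1 + (n : ℝ) ^ 2) ^ s := by positivity
  rw [coeff_add]
  nlinarith [mul_nonneg this (sq_nonneg (coeff n u - coeff n v))]

theorem MemHs.smul {s : ℝ} {u : L2w} (c : ℝ) (hu : MemHs s u) : MemHs s (c • u) := by
  refine (Summable.mul_left (c ^ 2) hu).congr fun n => ?_
  rw [coeff_smul]
  ring

theorem MemHs.sub {s : ℝ} {u v : L2w} (hu : MemHs s u) (hv : MemHs s v) : MemHs s (u - v) := by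
  simpa [sub_eq_add_neg] using hu.add (hv.smul (-1))

theorem hsNorm_smul (s c : ℝ) (u : L2w) : hsNorm s (c • u) = |c| * hsNorm s u := by
  rw [hsNorm, hsNorm, ← Real.sqrt_sq_eq_abs, ← Real.sqrt_mul (sq_nonneg c), ← tsum_mul_left]
  congr 2
  funext n
  rw [coeff_smul]
  ring

theorem hsNorm_add_sq_le {s : ℝ} {u v : L2w} (hu : MemHs s u) (hv : MemHs s v) :
    hsNorm s (u + v) ^ 2 ≤ 2 * hsNorm s u ^ 2 + 2 * hsNorm s v ^ 2 := by
  simp only [hsNorm_sq]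
  rw [← tsum_mul_left, ← tsum_mul_left, ← Summable.tsum_add (Summable.mul_left 2 hu)
    (Summable.mul_left 2 hv)]
  refine Summable.tsum_le_tsum (fun n => ?_) (hu.add hv)
    ((Summable.mul_left 2 hu).add (Summable.mul_left 2 hv))
  have : 0 ≤ (1 + (n : ℝ) ^ 2) ^ s := by positivity
  rw [coeff_add]
  nlinarith [mul_nonneg this (sq_nonneg (coeff n u - coeff n v))]

theorem hsNorm_sub_sq_le {s : ℝ} {u v : L2w} (hu : MemHs s u) (hv : MemHs s v) :
    hsNorm s (u - v) ^ 2 ≤ 2 * hsNorm s u ^ 2 + 2 * hsNorm s v ^ 2 := by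
  have h := hsNorm_add_sq_le hu (hv.smul (-1))
  rw [hsNorm_smul] at h
  simpa [sub_eq_add_neg] using h

theorem MemHs.mono {r s : ℝ} (hrs : r ≤ s) {u : L2w} (hu : MemHs s u) : MemHs r u := by
  refine Summable.of_nonneg_of_le (hs_term_nonneg r _) (fun n => ?_) hu
  have h1 : (1 : ℝ) ≤ 1 + (n : ℝ) ^ 2 := by nlinarith [sq_nonneg (n : ℝ)]
  exact mul_le_mul_of_nonneg_right (Real.rpow_le_rpow_of_exponent_le h1 hrs) (sq_nonneg _)

theorem hsNorm_mono {r s : ℝ} (hrs : r ≤ s) {u : L2w} (hu : MemHs s u) :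
    hsNorm r u ≤ hsNorm s u := by
  refine Real.sqrt_le_sqrt (Summable.tsum_le_tsum (fun n => ?_) (hu.mono hrs) hu)
  have h1 : (1 : ℝ) ≤ 1 + (n : ℝ) ^ 2 := by nlinarith [sq_nonneg (n : ℝ)]
  exact mul_le_mul_of_nonneg_right (Real.rpow_le_rpow_of_exponent_le h1 hrs) (sq_nonneg _)

theorem memHs_of_mem_polySpace (s : ℝ) {N : ℕ} {u : L2w} (hu : u ∈ polySpace N) : MemHs s u := by
  refine summable_of_ne_finset_zero (s := Finset.range (N + 1)) fun n hn => ?_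
  rw [coeff_eq_zero_of_mem_polySpace (by simpa using hn) hu]
  simp

/-- Inverse inequality on `S_N`. -/
theorem hsNorm_one_sq_le_of_mem_polySpace {N : ℕ} {u : L2w} (hu : u ∈ polySpace N) :
    hsNorm 1 u ^ 2 ≤ (1 + (N : ℝ) ^ 2) * ‖u‖ ^ 2 := by
  rw [hsNorm_sq, ← (hasSum_coeff_sq u).tsum_eq, ← tsum_mul_left]
  refine Summable.tsum_le_tsum (fun n => ?_) (memHs_of_mem_polySpace 1 hu)
    (Summable.mul_left _ (hasSum_coeff_sq u).summable)
  rw [Real.rpow_one]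
  rcases le_or_gt n N with h | h
  · gcongr
  · simp [coeff_eq_zero_of_mem_polySpace h hu]

theorem MemHs.proj {s : ℝ} (N : ℕ) (u : L2w) : MemHs s (proj N u) :=
  memHs_of_mem_polySpace s (proj_mem_polySpace N u)

/-- The error of the Chebyshev projection in the scale of weighted Sobolev spaces. -/
theorem hsNorm_sub_proj_sq_le {r s : ℝ} (hrs : r ≤ s) {N : ℕ} (hN : 1 ≤ N) {u : L2w}
    (hu : MemHs s u) :
    hsNorm r (u - NonlocalSineGordon.proj N u) ^ 2 ≤ ((N : ℝ) ^ (r - s) * hsNorm s u) ^ 2 := by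
  have hN0 : (0 : ℝ) < N := by exact_mod_cast hN
  rw [mul_pow, hsNorm_sq, hsNorm_sq, ← tsum_mul_left]
  refine Summable.tsum_le_tsum (fun n => ?_) ((hu.mono hrs).sub (MemHs.proj N u))
    (Summable.mul_left _ hu)
  rcases le_or_gt n N with h | h
  · rw [coeff_sub_proj_of_le h]
    have := hs_term_nonneg s u n
    simp only [ne_eq, OfNat.ofNat_ne_zero, not_false_eq_true, zero_pow, mul_zero]
    positivity
  · rw [coeff_sub_proj_of_lt h, ← mul_assoc]
    refine mul_le_mul_of_nonneg_right ?_ (sq_nonneg _)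
    have h1 : (0 : ℝ) < 1 + (n : ℝ) ^ 2 := by positivity
    have h2 : (N : ℝ) ^ 2 ≤ 1 + (n : ℝ) ^ 2 := by
      have : (N : ℝ) ≤ n := by exact_mod_cast h.le
      nlinarith
    calc (1 + (n : ℝ) ^ 2) ^ r = (1 + (n : ℝ) ^ 2) ^ (r - s) * (1 + (n : ℝ) ^ 2) ^ s := by
          rw [← Real.rpow_add h1, sub_add_cancel]
      _ ≤ ((N : ℝ) ^ 2) ^ (r - s) * (1 + (n : ℝ) ^ 2) ^ s := by
          refine mul_le_mul_of_nonneg_right ?_ (by positivity)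
          exact Real.rpow_le_rpow_of_nonpos (by positivity) h2 (by linarith)
      _ = ((N : ℝ) ^ (r - s)) ^ 2 * (1 + (n : ℝ) ^ 2) ^ s := by
          rw [Real.rpow_pow_comm hN0.le]

theorem norm_sub_proj_le {s : ℝ} (hs : 0 ≤ s) {N : ℕ} (hN : 1 ≤ N) {u : L2w} (hu : MemHs s u) :
    ‖u - NonlocalSineGordon.proj N u‖ ≤ (N : ℝ) ^ (-s) * hsNorm s u := by
  have h := hsNorm_sub_proj_sq_le hs hN hu
  rw [hsNorm_zero, zero_sub] at h
  have := hsNorm_nonneg s u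
  exact le_of_sq_le_sq h (by positivity)

theorem coeFn_chebT_zero : ∀ᵐ x ∂chebMeasure, (chebT 0 : ℝ → ℝ) x = 1 := by
  filter_upwards [(memLp_polynomial (Polynomial.Chebyshev.T ℝ 0)).coeFn_toLp] with x h1
  rw [chebT, h1]
  simp

theorem integrable_L2w (u : L2w) : Integrable u (volume.restrict (Icc (-1 : ℝ) 1)) :=
  ((Lp.memLp u).integrable (by norm_num)).mono_measure restrict_le_chebMeasure

theorem integral_norm_le (u : L2w) : ∫ y in Icc (-1 : ℝ) 1, ‖u y‖ ≤ ‖chebT 0‖ * ‖u‖ := by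
  have hi : Integrable (fun y => ‖u y‖) chebMeasure :=
    ((Lp.memLp u).integrable (by norm_num)).norm
  calc ∫ y in Icc (-1 : ℝ) 1, ‖u y‖ ≤ ∫ y, ‖u y‖ ∂chebMeasure :=
        integral_mono_measure restrict_le_chebMeasure
          (Eventually.of_forall fun y => norm_nonneg _) hi
    _ = inner ℝ (chebT 0) |u| := by
        rw [L2.inner_def]
        refine integral_congr_ae ?_
        filter_upwards [coeFn_chebT_zero, Lp.coeFn_abs u] with y h1 h2
        rw [h1, h2]
        simp
    _ ≤ ‖chebT 0‖ * ‖|u|‖ := real_inner_le_norm _ _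
    _ = ‖chebT 0‖ * ‖u‖ := by rw [norm_abs_eq_norm]

theorem Kernel.bound_nonneg (k : Kernel) : 0 ≤ k.bound := (abs_nonneg _).trans (k.abs_le 0)

theorem integrable_kernel_mul (k : Kernel) (δ : ℝ) (u : L2w) (x : ℝ) :
    Integrable (fun y => k.toFun (x - y) * (u x - u y))
      (volume.restrict (Metric.ball x δ ∩ Icc (-1) 1)) := by
  have h : Integrable (fun y => u x - u y) (volume.restrict (Metric.ball x δ ∩ Icc (-1) 1)) :=
    ((integrable_const _).sub (integrable_L2w u)).mono_measure
      (Measure.restrict_mono inter_subset_right le_rfl)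
  refine h.bdd_mul (c := k.bound) ?_ (Eventually.of_forall fun y => k.abs_le _)
  exact (k.measurable.comp (measurable_const.sub measurable_id)).aestronglyMeasurable

theorem abs_nonlocalFun_sub_le (k : Kernel) (δ : ℝ) (u v : L2w) {x : ℝ}
    (hx : (u - v : L2w) x = u x - v x) :
    |nonlocalFun k δ u x - nonlocalFun k δ v x| ≤
      k.bound * (2 * |(u - v : L2w) x| + ∫ y in Icc (-1 : ℝ) 1, ‖(u - v : L2w) y‖) := by
  set w : L2w := u - v with hw
  have hM := k.bound_nonneg
  have hint := integrable_L2w w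
  have hdom : Integrable (fun y => k.bound * (‖w x‖ + ‖w y‖)) (volume.restrict (Icc (-1 : ℝ) 1)) :=
    ((integrable_const _).add hint.norm).const_mul _
  have hae : ∀ᵐ y ∂(volume.restrict (Metric.ball x δ ∩ Icc (-1) 1)), w y = u y - v y :=
    (Measure.absolutelyContinuous_of_le ((Measure.restrict_mono inter_subset_right le_rfl).trans
      restrict_le_chebMeasure)).ae_le (Lp.coeFn_sub u v)
  rw [← Real.norm_eq_abs (_ - _), nonlocalFun, nonlocalFun,
    ← integral_sub (integrable_kernel_mul k δ u x) (integrable_kernel_mul k δ v x)]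
  calc ‖∫ y in Metric.ball x δ ∩ Icc (-1) 1,
        (k.toFun (x - y) * (u x - u y) - k.toFun (x - y) * (v x - v y))‖
      ≤ ∫ y in Metric.ball x δ ∩ Icc (-1) 1, k.bound * (‖w x‖ + ‖w y‖) := by
        refine norm_integral_le_of_norm_le
          (hdom.mono_measure (Measure.restrict_mono inter_subset_right le_rfl)) ?_
        filter_upwards [hae] with y hy
        have : k.toFun (x - y) * (u x - u y) - k.toFun (x - y) * (v x - v y) =
            k.toFun (x - y) * (w x - w y) := by
          rw [hx, hy]
          ring
        rw [this, norm_mul]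
        exact mul_le_mul (k.abs_le _) (norm_sub_le _ _) (norm_nonneg _) hM
    _ ≤ ∫ y in Icc (-1 : ℝ) 1, k.bound * (‖w x‖ + ‖w y‖) :=
        setIntegral_mono_set hdom (Eventually.of_forall fun y => by positivity)
          (Eventually.of_forall inter_subset_right)
    _ = k.bound * (2 * |w x| + ∫ y in Icc (-1 : ℝ) 1, ‖w y‖) := by
        rw [integral_const_mul, integral_add (integrable_const _) hint.norm]
        have h2 : ∫ _ in Icc (-1 : ℝ) 1, ‖w x‖ = 2 * |w x| := by
          rw [setIntegral_const, Measure.real, Real.volume_Icc]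
          norm_num
        rw [h2]

theorem norm_peridynamicOp_sub_le (k : Kernel) (δ : ℝ) (u v : L2w) :
    ‖peridynamicOp k δ u - peridynamicOp k δ v‖ ≤
      k.bound * (2 + ‖chebT 0‖ ^ 2) * ‖u - v‖ := by
  have hM := k.bound_nonneg
  set w : L2w := u - v with hw
  set I : ℝ := ∫ y in Icc (-1 : ℝ) 1, ‖w y‖ with hI
  have hI0 : 0 ≤ I := integral_nonneg fun _ => norm_nonneg _
  have hIle : I ≤ ‖chebT 0‖ * ‖w‖ := integral_norm_le w
  have h1 : ‖peridynamicOp k δ u - peridynamicOp k δ v‖ ≤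
      ‖(2 * k.bound) • |w| + (k.bound * I) • chebT 0‖ := by
    refine Lp.norm_le_norm_of_ae_le ?_
    filter_upwards [Lp.coeFn_sub u v, Lp.coeFn_sub (peridynamicOp k δ u) (peridynamicOp k δ v),
      (memLp_nonlocalFun k δ u).coeFn_toLp, (memLp_nonlocalFun k δ v).coeFn_toLp,
      Lp.coeFn_add ((2 * k.bound) • |w|) ((k.bound * I) • chebT 0),
      Lp.coeFn_smul (2 * k.bound) |w|, Lp.coeFn_smul (k.bound * I) (chebT 0), Lp.coeFn_abs w,
      coeFn_chebT_zero] with x e1 e2 e3 e4 e5 e6 e7 e8 e9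
    have e3' : (peridynamicOp k δ u : ℝ → ℝ) x = nonlocalFun k δ u x := e3
    have e4' : (peridynamicOp k δ v : ℝ → ℝ) x = nonlocalFun k δ v x := e4
    rw [e2, e5, Pi.sub_apply, Pi.add_apply, e6, e7, Pi.smul_apply, Pi.smul_apply, e8, e9, e3', e4',
      Real.norm_eq_abs, Real.norm_eq_abs]
    refine (abs_nonlocalFun_sub_le k δ u v e1).trans (le_trans (le_of_eq ?_) (le_abs_self _))
    simp only [smul_eq_mul, ← hw, ← hI]
    ring
  have h2 : ‖(2 * k.bound) • |w| + (k.bound * I) • chebT 0‖ ≤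
      2 * k.bound * ‖w‖ + k.bound * I * ‖chebT 0‖ := by
    refine (norm_add_le _ _).trans_eq ?_
    rw [norm_smul, norm_smul, norm_abs_eq_norm, Real.norm_of_nonneg (by positivity),
      Real.norm_of_nonneg (by positivity)]
  have h3 : k.bound * I * ‖chebT 0‖ ≤ k.bound * (‖chebT 0‖ * ‖w‖) * ‖chebT 0‖ := by gcongr
  nlinarith

theorem norm_sinOp_sub_le (u v : L2w) : ‖sinOp u - sinOp v‖ ≤ ‖u - v‖ := by
  simpa [sinOp] using lipschitzWith_sin.norm_compLp_sub_le Real.sin_zero u v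

theorem timeDeriv_sub {T t : ℝ} {u v : ℝ → L2w}
    (hu : DifferentiableWithinAt ℝ u (Icc 0 T) t) (hv : DifferentiableWithinAt ℝ v (Icc 0 T) t) :
    timeDeriv T (fun r => u r - v r) t = timeDeriv T u t - timeDeriv T v t :=
  derivWithin_fun_sub hu hv

theorem tendsto_hsNorm_sub {α : Type*} {l : Filter α} {s : ℝ} {f g : α → L2w}
    (hf : ∀ᶠ a in l, MemHs s (f a)) (hg : ∀ᶠ a in l, MemHs s (g a))
    (hf0 : Tendsto (fun a => hsNorm s (f a)) l (𝓝 0))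
    (hg0 : Tendsto (fun a => hsNorm s (g a)) l (𝓝 0)) :
    Tendsto (fun a => hsNorm s (f a - g a)) l (𝓝 0) := by
  have h := (((hf0.pow 2).const_mul 2).add ((hg0.pow 2).const_mul 2)).sqrt
  simp only [ne_eq, OfNat.ofNat_ne_zero, not_false_eq_true, zero_pow, mul_zero, add_zero,
    Real.sqrt_zero] at h
  refine tendsto_of_tendsto_of_tendsto_of_le_of_le' tendsto_const_nhds h
    (Eventually.of_forall fun a => hsNorm_nonneg s _) ?_
  filter_upwards [hf, hg] with a ha hb
  exact Real.le_sqrt_of_sq_le (hsNorm_sub_sq_le ha hb)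

theorem MemX.memHs_quotient {s T : ℝ} {u : ℝ → L2w} (hu : MemX s T u) {t : ℝ} (ht : t ∈ Icc 0 T) :
    ∀ᶠ r in 𝓝[Icc 0 T \ {t}] t, MemHs s ((r - t)⁻¹ • (u r - u t) - timeDeriv T u t) := by
  filter_upwards [self_mem_nhdsWithin] with r hr
  exact (((hu.memHs r hr.1).sub (hu.memHs t ht)).smul _).sub (hu.memHs_timeDeriv t ht)

theorem MemX.mono {r s T : ℝ} (hrs : r ≤ s) {u : ℝ → L2w} (hu : MemX s T u) : MemX r T u where
  memHs t ht := (hu.memHs t ht).mono hrs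
  memHs_timeDeriv t ht := (hu.memHs_timeDeriv t ht).mono hrs
  differentiable := hu.differentiable
  tendsto_quotient t ht := by
    refine tendsto_of_tendsto_of_tendsto_of_le_of_le' tendsto_const_nhds (hu.tendsto_quotient t ht)
      (Eventually.of_forall fun a => hsNorm_nonneg r _) ?_
    filter_upwards [hu.memHs_quotient ht] with a ha
    exact hsNorm_mono hrs ha
  continuous_timeDeriv t ht := by
    refine tendsto_of_tendsto_of_tendsto_of_le_of_le' tendsto_const_nhds
      (hu.continuous_timeDeriv t ht) (Eventually.of_forall fun a => hsNorm_nonneg r _) ?_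
    filter_upwards [self_mem_nhdsWithin] with a ha
    exact hsNorm_mono hrs ((hu.memHs_timeDeriv a ha).sub (hu.memHs_timeDeriv t ht))

theorem MemX.sub {s T : ℝ} {u v : ℝ → L2w} (hu : MemX s T u) (hv : MemX s T v) :
    MemX s T (fun t => u t - v t) where
  memHs t ht := (hu.memHs t ht).sub (hv.memHs t ht)
  memHs_timeDeriv t ht := by
    rw [timeDeriv_sub (hu.differentiable t ht) (hv.differentiable t ht)]
    exact (hu.memHs_timeDeriv t ht).sub (hv.memHs_timeDeriv t ht)
  differentiable t ht := (hu.differentiable t ht).fun_sub (hv.differentiable t ht)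
  tendsto_quotient t ht := by
    rw [timeDeriv_sub (hu.differentiable t ht) (hv.differentiable t ht)]
    refine (tendsto_hsNorm_sub (hu.memHs_quotient ht) (hv.memHs_quotient ht)
      (hu.tendsto_quotient t ht) (hv.tendsto_quotient t ht)).congr fun r => ?_
    congr 1
    module
  continuous_timeDeriv t ht := by
    rw [timeDeriv_sub (hu.differentiable t ht) (hv.differentiable t ht)]
    refine (tendsto_hsNorm_sub ?_ ?_ (hu.continuous_timeDeriv t ht)
      (hv.continuous_timeDeriv t ht)).congr' ?_
    · filter_upwards [self_mem_nhdsWithin] with r hr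
      exact (hu.memHs_timeDeriv r hr).sub (hu.memHs_timeDeriv t ht)
    · filter_upwards [self_mem_nhdsWithin] with r hr
      exact (hv.memHs_timeDeriv r hr).sub (hv.memHs_timeDeriv t ht)
    · filter_upwards [self_mem_nhdsWithin] with r hr
      rw [timeDeriv_sub (hu.differentiable r hr) (hv.differentiable r hr)]
      congr 1
      abel

theorem proj_eq_self {N : ℕ} {u : L2w} (hu : u ∈ polySpace N) : proj N u = u :=
  Submodule.starProjection_eq_self_iff.2 hu

theorem timeDeriv_mem_polySpace {T : ℝ} {N : ℕ} {u : ℝ → L2w} (hT : 0 < T)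
    (hu : ∀ t ∈ Icc 0 T, u t ∈ polySpace N)
    (hd : ∀ t ∈ Icc 0 T, DifferentiableWithinAt ℝ u (Icc 0 T) t) {t : ℝ} (ht : t ∈ Icc 0 T) :
    timeDeriv T u t ∈ polySpace N := by
  have h1 : HasDerivWithinAt (fun r => proj N (u r)) (proj N (timeDeriv T u t)) (Icc 0 T) t :=
    (proj N).hasFDerivAt.comp_hasDerivWithinAt t (hd t ht).hasDerivWithinAt
  have h2 : HasDerivWithinAt u (proj N (timeDeriv T u t)) (Icc 0 T) t :=
    h1.congr (fun r hr => (proj_eq_self (hu r hr)).symm) (proj_eq_self (hu t ht)).symm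
  have h3 : timeDeriv T u t = proj N (timeDeriv T u t) :=
    h2.derivWithin (uniqueDiffOn_Icc hT t ht)
  rw [h3]
  exact proj_mem_polySpace N _

theorem tendsto_hsNorm_one_of_polySpace {α : Type*} {l : Filter α} {N : ℕ} {f : α → L2w}
    (hf : ∀ᶠ a in l, f a ∈ polySpace N) (h0 : Tendsto f l (𝓝 0)) :
    Tendsto (fun a => hsNorm 1 (f a)) l (𝓝 0) := by
  have h := (((h0.norm).pow 2).const_mul (1 + (N : ℝ) ^ 2)).sqrt
  simp only [norm_zero, ne_eq, OfNat.ofNat_ne_zero, not_false_eq_true, zero_pow, mul_zero,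
    Real.sqrt_zero] at h
  refine tendsto_of_tendsto_of_tendsto_of_le_of_le' tendsto_const_nhds h
    (Eventually.of_forall fun a => hsNorm_nonneg 1 _) ?_
  filter_upwards [hf] with a ha
  exact Real.le_sqrt_of_sq_le (hsNorm_one_sq_le_of_mem_polySpace ha)

theorem memX_one_of_mem_polySpace {T : ℝ} {N : ℕ} {u : ℝ → L2w} (hT : 0 < T)
    (hu : ∀ t ∈ Icc 0 T, u t ∈ polySpace N)
    (hd : ∀ t ∈ Icc 0 T, DifferentiableWithinAt ℝ u (Icc 0 T) t)
    (hc : ContinuousOn (timeDeriv T u) (Icc 0 T)) : MemX 1 T u where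
  memHs t ht := memHs_of_mem_polySpace 1 (hu t ht)
  memHs_timeDeriv t ht := memHs_of_mem_polySpace 1 (timeDeriv_mem_polySpace hT hu hd ht)
  differentiable := hd
  tendsto_quotient t ht := by
    refine tendsto_hsNorm_one_of_polySpace (N := N) ?_ ?_
    · filter_upwards [self_mem_nhdsWithin] with r hr
      exact Submodule.sub_mem _ (Submodule.smul_mem _ _ (Submodule.sub_mem _ (hu r hr.1) (hu t ht)))
        (timeDeriv_mem_polySpace hT hu hd ht)
    · have h := hasDerivWithinAt_iff_tendsto_slope.1 (hd t ht).hasDerivWithinAt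
      have h2 := h.sub_const (derivWithin u (Icc 0 T) t)
      rw [sub_self] at h2
      exact h2
  continuous_timeDeriv t ht := by
    refine tendsto_hsNorm_one_of_polySpace (N := N) ?_ ?_
    · filter_upwards [self_mem_nhdsWithin] with r hr
      exact Submodule.sub_mem _ (timeDeriv_mem_polySpace hT hu hd hr)
        (timeDeriv_mem_polySpace hT hu hd ht)
    · have h2 := (hc t ht).tendsto.sub_const (timeDeriv T u t)
      rw [sub_self] at h2
      exact h2

theorem MemX.locally_bounded {s T : ℝ} {u : ℝ → L2w} (hu : MemX s T u) {t : ℝ}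
    (ht : t ∈ Icc 0 T) : ∃ B : ℝ, ∀ᶠ r in 𝓝[Icc 0 T] t,
      hsNorm s (u r) ^ 2 + hsNorm s (timeDeriv T u r) ^ 2 ≤ B := by
  set a := hsNorm s (u t) ^ 2 with ha
  set b := hsNorm s (timeDeriv T u t) ^ 2 with hb
  have ha0 : 0 ≤ a := sq_nonneg _
  have hb0 : 0 ≤ b := sq_nonneg _
  refine ⟨2 * (T ^ 2 * (2 * 1 + 2 * b)) + 2 * a + (2 * 1 + 2 * b), ?_⟩
  have h1 : ∀ᶠ r in 𝓝[Icc 0 T] t, hsNorm s (timeDeriv T u r - timeDeriv T u t) < 1 :=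
    (hu.continuous_timeDeriv t ht).eventually_lt_const one_pos
  have h2 : ∀ᶠ r in 𝓝[Icc 0 T \ {t}] t,
      hsNorm s ((r - t)⁻¹ • (u r - u t) - timeDeriv T u t) < 1 :=
    (hu.tendsto_quotient t ht).eventually_lt_const one_pos
  rw [eventually_nhdsWithin_iff] at h2
  filter_upwards [h1, mem_nhdsWithin_of_mem_nhds h2, self_mem_nhdsWithin] with r hr1 hr2 hr
  refine add_le_add ?_ ?_
  · rcases eq_or_ne r t with rfl | hne
    · have : 0 ≤ T ^ 2 * (2 * 1 + 2 * b) := by positivity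
      rw [← ha]
      linarith
    · have hq := hr2 ⟨hr, hne⟩
      set q := (r - t)⁻¹ • (u r - u t) - timeDeriv T u t with hqdef
      have hqm : MemHs s q :=
        (((hu.memHs r hr).sub (hu.memHs t ht)).smul _).sub (hu.memHs_timeDeriv t ht)
      have hd := hu.memHs_timeDeriv t ht
      have he : u r = (r - t) • (q + timeDeriv T u t) + u t := by
        rw [hqdef, sub_add_cancel, smul_inv_smul₀ (sub_ne_zero.2 hne), sub_add_cancel]
      rw [he]
      refine (hsNorm_add_sq_le ((hqm.add hd).smul _) (hu.memHs t ht)).trans ?_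
      rw [hsNorm_smul, mul_pow, sq_abs]
      have h3 : (r - t) ^ 2 ≤ T ^ 2 := by
        refine sq_le_sq' ?_ ?_ <;> linarith [hr.1, hr.2, ht.1, ht.2]
      have h4 : hsNorm s (q + timeDeriv T u t) ^ 2 ≤ 2 * 1 + 2 * b := by
        refine (hsNorm_add_sq_le hqm hd).trans ?_
        have := pow_le_one₀ (n := 2) (hsNorm_nonneg s q) hq.le
        linarith
      have h5 := mul_le_mul h3 h4 (sq_nonneg _) (sq_nonneg T)
      linarith
  · have h := hsNorm_add_sq_le ((hu.memHs_timeDeriv r hr).sub (hu.memHs_timeDeriv t ht))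
      (hu.memHs_timeDeriv t ht)
    rw [sub_add_cancel] at h
    have := pow_le_one₀ (n := 2) (hsNorm_nonneg s _) hr1.le
    linarith

theorem MemX.bddAbove {s T : ℝ} {u : ℝ → L2w} (hu : MemX s T u) :
    BddAbove (range fun t : Icc (0 : ℝ) T =>
      hsNorm s (u t) ^ 2 + hsNorm s (timeDeriv T u t) ^ 2) := by
  have h : ∃ B : ℝ, ∀ r ∈ Icc 0 T, hsNorm s (u r) ^ 2 + hsNorm s (timeDeriv T u r) ^ 2 ≤ B := by
    refine isCompact_Icc.induction_on (p := fun S => ∃ B : ℝ, ∀ r ∈ S,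
      hsNorm s (u r) ^ 2 + hsNorm s (timeDeriv T u r) ^ 2 ≤ B) ⟨0, by simp⟩ ?_ ?_ ?_
    · rintro S S' hS ⟨B, hB⟩
      exact ⟨B, fun r hr => hB r (hS hr)⟩
    · rintro S S' ⟨B, hB⟩ ⟨B', hB'⟩
      refine ⟨max B B', fun r hr => ?_⟩
      rcases hr with hr | hr
      · exact (hB r hr).trans (le_max_left _ _)
      · exact (hB' r hr).trans (le_max_right _ _)
    · intro t ht
      obtain ⟨B, hB⟩ := hu.locally_bounded ht
      exact ⟨_, hB, B, fun r hr => hr⟩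
  obtain ⟨B, hB⟩ := h
  exact ⟨B, by rintro _ ⟨t, rfl⟩; exact hB t t.2⟩

theorem MemX.le_xNorm_sq {s T : ℝ} {u : ℝ → L2w} (hu : MemX s T u) {t : ℝ} (ht : t ∈ Icc 0 T) :
    hsNorm s (u t) ^ 2 + hsNorm s (timeDeriv T u t) ^ 2 ≤ xNorm s T u ^ 2 := by
  have h := le_ciSup hu.bddAbove ⟨t, ht⟩
  rw [xNorm, Real.sq_sqrt ((by positivity : (0 : ℝ) ≤ _ ^ 2 + _ ^ 2).trans h)]
  exact h

theorem xNorm_nonneg (s T : ℝ) (u : ℝ → L2w) : 0 ≤ xNorm s T u := Real.sqrt_nonneg _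

theorem norm_proj_le (N : ℕ) (u : L2w) : ‖proj N u‖ ≤ ‖u‖ :=
  Submodule.norm_starProjection_apply_le _ _

/-- Gronwall estimate for a second order problem with vanishing initial data. -/
theorem norm_le_of_second_order {E : Type*} [NormedAddCommGroup E] [NormedSpace ℝ E]
    {e d f : ℝ → E} {T K ε : ℝ} (hK : 1 ≤ K) (hε : 0 ≤ ε)
    (he : ∀ t ∈ Icc 0 T, HasDerivWithinAt e (d t) (Icc 0 T) t)
    (hd : ∀ t ∈ Icc 0 T, HasDerivWithinAt d (f t) (Icc 0 T) t)
    (he0 : e 0 = 0) (hd0 : d 0 = 0) (hf : ∀ t ∈ Icc 0 T, ‖f t‖ ≤ K * (‖e t‖ + ε)) :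
    ∀ t ∈ Icc 0 T, ‖e t‖ ≤ ε * Real.exp (K * T) ∧ ‖d t‖ ≤ ε * Real.exp (K * T) := by
  have hp : ∀ t ∈ Icc 0 T, HasDerivWithinAt (fun r => (e r, d r)) (d t, f t) (Icc 0 T) t :=
    fun t ht => (he t ht).prodMk (hd t ht)
  have key := norm_le_gronwallBound_of_norm_deriv_right_le (f := fun r => (e r, d r))
    (f' := fun r => (d r, f r)) (δ := 0) (K := K) (ε := K * ε) (a := 0) (b := T)
    (fun t ht => (hp t ht).continuousWithinAt)
    (fun t ht => (hp t (Ico_subset_Icc_self ht)).mono_of_mem_nhdsWithin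
      (mem_of_superset (Icc_mem_nhdsGE ht.2) (Icc_subset_Icc_left ht.1)))
    (by simp [he0, hd0])
    (fun t ht => by
      have h1 : ‖e t‖ ≤ ‖(e t, d t)‖ := norm_fst_le (e t, d t)
      have h2 : ‖d t‖ ≤ ‖(e t, d t)‖ := norm_snd_le (e t, d t)
      have h3 := hf t (Ico_subset_Icc_self ht)
      have h4 : 0 ≤ ‖(e t, d t)‖ := norm_nonneg _
      have h5 := mul_nonneg (zero_le_one.trans hK) hε
      refine max_le ?_ ?_
      · show ‖d t‖ ≤ _
        nlinarith
      · show ‖f t‖ ≤ _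
        nlinarith)
  intro t ht
  have h := key t ht
  have hK0 : K ≠ 0 := by linarith
  rw [gronwallBound_of_K_ne_0 hK0, sub_zero] at h
  beta_reduce at h
  rw [zero_mul, zero_add, mul_div_cancel_left₀ _ hK0] at h
  have h2 : ε * (Real.exp (K * t) - 1) ≤ ε * Real.exp (K * T) := by
    refine mul_le_mul_of_nonneg_left ?_ hε
    have : Real.exp (K * t) ≤ Real.exp (K * T) :=
      Real.exp_le_exp.2 (mul_le_mul_of_nonneg_left ht.2 (by linarith))
    linarith
  exact ⟨(norm_fst_le (e t, d t)).trans (h.trans h2), (norm_snd_le (e t, d t)).trans (h.trans h2)⟩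

/-- A Lipschitz constant of the right-hand side `u ↦ ℒ u - sin u` in `L²_w`. -/
def lipConst (k : Kernel) : ℝ := k.bound * (2 + ‖chebT 0‖ ^ 2) + 1

theorem one_le_lipConst (k : Kernel) : 1 ≤ lipConst k := by
  have := k.bound_nonneg
  rw [lipConst]
  nlinarith [mul_nonneg this (by positivity : 0 ≤ 2 + ‖chebT 0‖ ^ 2)]

theorem norm_rhs_sub_le (k : Kernel) (δ : ℝ) (u v : L2w) :
    ‖(peridynamicOp k δ u - sinOp u) - (peridynamicOp k δ v - sinOp v)‖ ≤
      lipConst k * ‖u - v‖ := by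
  have h : (peridynamicOp k δ u - sinOp u) - (peridynamicOp k δ v - sinOp v) =
      (peridynamicOp k δ u - peridynamicOp k δ v) - (sinOp u - sinOp v) := by abel
  rw [h, lipConst, add_mul, one_mul]
  exact (norm_sub_le _ _).trans
    (add_le_add (norm_peridynamicOp_sub_le k δ u v) (norm_sinOp_sub_le u v))

/-- The Galerkin solution is close in `L²_w` to the projection of the exact solution. -/
theorem norm_proj_sub_galerkin_le {k : Kernel} {δ T s : ℝ} (hs : 0 ≤ s)
    {u₀ v : L2w} {u : ℝ → L2w} (hX : MemX s T u) (hu : IsSolution k δ T u₀ v u)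
    {N : ℕ} (hN : 1 ≤ N) {uN : ℝ → L2w} (huN : IsGalerkinSolution k δ T N u₀ v uN) :
    ∀ t ∈ Icc 0 T,
      ‖proj N (u t) - uN t‖ ≤
        (N : ℝ) ^ (-s) * xNorm s T u * Real.exp (lipConst k * T) ∧
      ‖proj N (timeDeriv T u t) - timeDeriv T uN t‖ ≤
        (N : ℝ) ^ (-s) * xNorm s T u * Real.exp (lipConst k * T) := by
  have hX0 := xNorm_nonneg s T u
  refine norm_le_of_second_order (e := fun t => proj N (u t) - uN t)
    (d := fun t => proj N (timeDeriv T u t) - timeDeriv T uN t)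
    (f := fun t => proj N (peridynamicOp k δ (u t) - sinOp (u t)) -
      (proj N (peridynamicOp k δ (uN t)) - proj N (sinOp (uN t))))
    (one_le_lipConst k) (by positivity) (fun t ht => ?_) (fun t ht => ?_) ?_ ?_ fun t ht => ?_
  · exact ((proj N).hasFDerivAt.comp_hasDerivWithinAt t
      (hu.differentiable t ht).hasDerivWithinAt).fun_sub (huN.differentiable t ht).hasDerivWithinAt
  · exact ((proj N).hasFDerivAt.comp_hasDerivWithinAt t (hu.equation t ht)).fun_sub
      (huN.equation t ht)
  · simp only [hu.initial, huN.initial, sub_self]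
  · simp only [hu.initial_timeDeriv, huN.initial_timeDeriv, sub_self]
  · rw [← map_sub, ← map_sub]
    refine (norm_proj_le N _).trans ((norm_rhs_sub_le k δ _ _).trans ?_)
    refine mul_le_mul_of_nonneg_left ?_ (zero_le_one.trans (one_le_lipConst k))
    have h1 : u t - uN t = (proj N (u t) - uN t) + (u t - proj N (u t)) := by abel
    rw [h1]
    refine (norm_add_le _ _).trans (add_le_add le_rfl ((norm_sub_proj_le hs hN
      (hX.memHs t ht)).trans (mul_le_mul_of_nonneg_left ?_ (by positivity))))
    refine le_of_sq_le_sq ?_ hX0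
    nlinarith [hX.le_xNorm_sq ht, sq_nonneg (hsNorm s (timeDeriv T u t))]

/-- Splitting of the `H¹_w` error into a projection error and a discrete error. -/
theorem hsNorm_one_sub_sq_le {s : ℝ} (hs : 1 ≤ s) {N : ℕ} (hN : 1 ≤ N) {u w : L2w} {B : ℝ}
    (hu : MemHs s u) (hw : w ∈ polySpace N) (h : ‖proj N u - w‖ ≤ (N : ℝ) ^ (-s) * B) :
    hsNorm 1 (u - w) ^ 2 ≤ ((N : ℝ) ^ (1 - s)) ^ 2 * (2 * hsNorm s u ^ 2 + 4 * B ^ 2) := by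
  have hN1 : (1 : ℝ) ≤ N := by exact_mod_cast hN
  have hm : proj N u - w ∈ polySpace N := Submodule.sub_mem _ (proj_mem_polySpace N u) hw
  have h1 : u - w = (u - proj N u) + (proj N u - w) := by abel
  have h2 := hsNorm_add_sq_le ((hu.mono hs).sub (MemHs.proj N u)) (memHs_of_mem_polySpace 1 hm)
  rw [← h1] at h2
  have h3 := hsNorm_sub_proj_sq_le hs hN hu
  have h4 := hsNorm_one_sq_le_of_mem_polySpace hm
  have h5 : ‖proj N u - w‖ ^ 2 ≤ ((N : ℝ) ^ (-s) * B) ^ 2 :=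
    pow_le_pow_left₀ (norm_nonneg _) h 2
  have h6 : (1 + (N : ℝ) ^ 2) * ‖proj N u - w‖ ^ 2 ≤
      2 * ((N : ℝ) * ((N : ℝ) ^ (-s) * B)) ^ 2 := by
    have : 1 + (N : ℝ) ^ 2 ≤ 2 * (N : ℝ) ^ 2 := by nlinarith
    have := mul_le_mul this h5 (sq_nonneg _) (by positivity)
    refine this.trans_eq ?_
    ring
  have h7 : (N : ℝ) * ((N : ℝ) ^ (-s) * B) = (N : ℝ) ^ (1 - s) * B := by
    rw [← mul_assoc, sub_eq_add_neg, Real.rpow_add (by linarith), Real.rpow_one]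
  rw [h7, mul_pow] at h6
  rw [mul_pow] at h3
  linarith

end NonlocalSineGordon

end

open NonlocalSineGordon in
theorem theorem1 (k : NonlocalSineGordon.Kernel) (δ T : ℝ) (hδ : 0 < δ) (hT : 0 < T) :
    ∃ C : ℝ, 0 < C ∧
      ∀ (s : ℝ), 1 ≤ s →
      ∀ (u₀ v : NonlocalSineGordon.L2w),
        NonlocalSineGordon.MemHs s u₀ → NonlocalSineGordon.MemHs s v →
      ∀ (u : ℝ → NonlocalSineGordon.L2w),
        NonlocalSineGordon.MemX s T u → NonlocalSineGordon.IsSolution k δ T u₀ v u →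
      ∀ (N : ℕ), 1 ≤ N →
      ∀ (uN : ℝ → NonlocalSineGordon.L2w),
        NonlocalSineGordon.IsGalerkinSolution k δ T N u₀ v uN →
        NonlocalSineGordon.MemX 1 T (fun t => u t - uN t) ∧
        NonlocalSineGordon.xNorm 1 T (fun t => u t - uN t) ≤
          C * (N : ℝ) ^ (1 - s) * NonlocalSineGordon.xNorm s T u := by
  set E := Real.exp (lipConst k * T) with hE
  have hE1 : 1 ≤ E :=
    Real.one_le_exp (mul_nonneg (zero_le_one.trans (one_le_lipConst k)) hT.le)
  refine ⟨4 * E, by positivity, fun s hs u₀ v _ _ u hX hu N hN uN huN => ⟨?_, ?_⟩⟩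
  · exact (hX.mono hs).sub (memX_one_of_mem_polySpace hT huN.mem_polySpace huN.differentiable
      fun t ht => (huN.equation t ht).continuousWithinAt)
  · have hX0 := xNorm_nonneg s T u
    have : Nonempty (Icc (0 : ℝ) T) := ⟨⟨0, le_rfl, hT.le⟩⟩
    refine Real.sqrt_le_iff.2 ⟨by positivity, ciSup_le fun ⟨t, ht⟩ => ?_⟩
    rw [timeDeriv_sub (hX.differentiable t ht) (huN.differentiable t ht)]
    obtain ⟨h1, h2⟩ := norm_proj_sub_galerkin_le (by linarith) hX hu hN huN t ht
    rw [mul_assoc] at h1 h2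
    have h3 := hsNorm_one_sub_sq_le hs hN (hX.memHs t ht) (huN.mem_polySpace t ht) h1
    have h4 := hsNorm_one_sub_sq_le hs hN (hX.memHs_timeDeriv t ht)
      (timeDeriv_mem_polySpace hT huN.mem_polySpace huN.differentiable ht) h2
    have h5 := hX.le_xNorm_sq ht
    refine (add_le_add h3 h4).trans ?_
    rw [← mul_add, mul_right_comm, mul_pow _ ((N : ℝ) ^ (1 - s)),
      mul_comm _ (((N : ℝ) ^ (1 - s)) ^ 2)]
    refine mul_le_mul_of_nonneg_left ?_ (sq_nonneg _)
    rw [← hE]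
    have h6 : xNorm s T u ^ 2 * 1 ≤ xNorm s T u ^ 2 * E ^ 2 :=
      mul_le_mul_of_nonneg_left (one_le_pow₀ hE1) (sq_nonneg _)
    nlinarith
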